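/- \textbf{Setting.} Let $g\in\mathbb N$ and let $\Theta\subseteq\mathbb R^{g}$ be open. For each sample size $n$ let $\nu_n$ be a measure on a measurable space $\mathcal X_n$ and let $\{f_n(\cdot;\theta):\theta\in\Theta\}$ be a family of probability densities with respect to $\nu_n$ (these make up a model class $\mathcal M_m$; the index $m$ is suppressed, and no independence structure is imposed). Let $F_n(\theta)$ be the distribution with density $f_n(\cdot;\theta)$, and write $U_n(\theta;x)=\nabla_\theta\log f_n(x;\theta)$ for the score, $A_n(\theta;x)=-\nabla^2_{\theta}\log f_n(x;\theta)$ for the observed information, and $\mathfrak I_n(\theta)=E_{F_n(\theta)}\bigl[U_n(\theta;X_n)U_n(\theta;X_n)^{\mathsf t}\bigr]$ for the Fisher information matrix. Suppose that the model class holds with true parameter $\theta_0\in\Theta$, i.e. $X_n\sim F_n(\theta_0)$ for every $n$, and that the following regularity conditions hold. \begin{enumerate} \item For every $n$ and $\nu_n$-almost every $x$: the map $\theta\mapsto f_n(x;\theta)$ is $C^2$ on $\Theta$, and it is either positive on all of $\Theta$ or zero on all of $\Theta$. \item The score $U_n(\theta_0;X_n)$ has finite second moments under $F_n(\theta_0)$,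 and the limiting Fisher information $\mathfrak I=\lim_{n\to\infty}\frac1n\mathfrak I_n(\theta_0)$ exists and is positive definite. \item There are a neighbourhood $W$ of $\theta_0$ and a matrix-valued function $J$, continuous at $\theta_0$ with $J(\theta_0)=\mathfrak I$, such that $\sup_{\theta\in W\cap\Theta}\bigl\|\frac1nA_n(\theta;X_n)-J(\theta)\bigr\|\to0$ in probability under $F_n(\theta_0)$ and also under $F_n(\theta_0+h/\sqrt n)$ for every fixed $h\in\mathbb R^g$. \item (Identifiability.) Every $\theta\in\Theta$ with $\theta\ne\theta_0$ has a neighbourhood $V$ such that the probability under $F_n(\theta_0)$ that $f_n(X_n;\theta')\ge f_n(X_n;\theta_0)$ for some $\theta'\in V\cap\Theta$ tends to $0$; and there is a compact set $C\subseteq\Theta$ such that the same holds with $\Theta\setminus C$ in place of $V\cap\Theta$. \end{enumerate} (Here and below, probabilities of sets that need not be measurable are outer probabilities.) Let $\hat\theta_n:\mathcal X_n\to\Theta$ be maximum likelihood estimators, i.e. measurable maps such that the probability under $F_n(\theta_0)$ that $\hat\theta_n(X_n)$ maximizes $\theta\mapsto f_n(X_n;\theta)$ over $\Theta$ tends to $1$,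 in the sense that the outer probability of the complementary event tends to $0$. Let $\tau:\Theta\to\mathbb R$ be differentiable, and put $\dot\tau=\nabla\tau(\theta_0)$. \textbf{Claim.} As $n\to\infty$, under $F_n(\theta_0)$, $$\sqrt n\,\bigl(\tau(\hat\theta_n)-\tau(\theta_0)\bigr)\ \xrightarrow{\ d\ }\ N\bigl(0,\ \dot\tau^{\mathsf t}\,\mathfrak I^{-1}\,\dot\tau\bigr),$$ where $\dot\tau^{\mathsf t}\mathfrak I^{-1}\dot\tau\ge 0$ and the normal law with variance $0$ is the point mass at $0$. -/

import Mathlib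

open MeasureTheory ProbabilityTheory Filter Topology Matrix
open scoped ENNReal NNReal

noncomputable section

/-- The vector `∇φ(θ)` of partial derivatives of `φ : ℝ^g → ℝ` at `θ`. -/
def gradVec {g : ℕ} (φ : EuclideanSpace ℝ (Fin g) → ℝ) (θ : EuclideanSpace ℝ (Fin g)) :
    Fin g → ℝ :=
  fun i => fderiv ℝ φ θ (EuclideanSpace.single i 1)

/-- The matrix `∇²φ(θ)` of second partial derivatives of `φ : ℝ^g → ℝ` at `θ`. -/
def hessMat {g : ℕ} (φ : EuclideanSpace ℝ (Fin g) → ℝ) (θ : EuclideanSpace ℝ (Fin g)) :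
    Matrix (Fin g) (Fin g) ℝ :=
  Matrix.of fun i j =>
    fderiv ℝ (fderiv ℝ φ) θ (EuclideanSpace.single i 1) (EuclideanSpace.single j 1)

/-- A parametric model class: for every sample size `n`, a family of probability densities
`f n θ` with respect to the dominating measure `ν n` on the sample space `𝒳 n`, indexed by the
points `θ` of one open set `Θ ⊆ ℝ^g`. No independence or product structure is imposed. -/
structure ModelClass {𝒳 : ℕ → Type*} [∀ n, MeasurableSpace (𝒳 n)]
    (ν : ∀ n, Measure (𝒳 n)) (g : ℕ) where
  /-- the parameter space -/
  Θ : Set (EuclideanSpace ℝ (Fin g))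
  isOpen_Θ : IsOpen Θ
  /-- the densities; their values at parameters outside `Θ` are irrelevant -/
  f : (n : ℕ) → EuclideanSpace ℝ (Fin g) → 𝒳 n → ℝ
  measurable_f : ∀ n, ∀ θ ∈ Θ, Measurable (f n θ)
  f_nonneg : ∀ n, ∀ θ ∈ Θ, ∀ x, 0 ≤ f n θ x
  lintegral_f : ∀ n, ∀ θ ∈ Θ, ∫⁻ x, ENNReal.ofReal (f n θ x) ∂(ν n) = 1

namespace ModelClass

variable {𝒳 : ℕ → Type*} [∀ n, MeasurableSpace (𝒳 n)] {ν : ∀ n, Measure (𝒳 n)} {g : ℕ}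

/-- The distribution `F_n(θ)` of the data `X_n` under the parameter `θ`. -/
def law (M : ModelClass ν g) (n : ℕ) (θ : EuclideanSpace ℝ (Fin g)) : Measure (𝒳 n) :=
  (ν n).withDensity fun x => ENNReal.ofReal (M.f n θ x)

instance isProbabilityMeasure_law (M : ModelClass ν g) (n : ℕ) (θ : M.Θ) :
    IsProbabilityMeasure (M.law n θ) :=
  ⟨by rw [law, withDensity_apply _ MeasurableSet.univ, Measure.restrict_univ,
    M.lintegral_f n θ θ.2]⟩

/-- The log-likelihood `log f_n(x; θ)` as a function of the parameter. -/
def logLik (M : ModelClass ν g) (n : ℕ) (x : 𝒳 n) (θ : EuclideanSpace ℝ (Fin g)) : ℝ :=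
  Real.log (M.f n θ x)

/-- The score vector `U_n(θ; x) = ∇_θ log f_n(x; θ)`. -/
def score (M : ModelClass ν g) (n : ℕ) (θ : EuclideanSpace ℝ (Fin g)) (x : 𝒳 n) : Fin g → ℝ :=
  gradVec (M.logLik n x) θ

/-- The observed information matrix `A_n(θ; x) = -∇²_θ log f_n(x; θ)`. -/
def obsInfo (M : ModelClass ν g) (n : ℕ) (θ : EuclideanSpace ℝ (Fin g)) (x : 𝒳 n) :
    Matrix (Fin g) (Fin g) ℝ :=
  -hessMat (M.logLik n x) θ

/-- The Fisher information matrix `E_θ[U_n(θ; X_n) U_n(θ; X_n)ᵀ]` of the data `X_n`. -/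
def fisherInfo (M : ModelClass ν g) (n : ℕ) (θ : EuclideanSpace ℝ (Fin g)) :
    Matrix (Fin g) (Fin g) ℝ :=
  Matrix.of fun i j => ∫ x, M.score n θ x i * M.score n θ x j ∂(M.law n θ)

/-- `I` is the limiting Fisher information matrix at `θ`: the scores have finite second moments
and `(1/n) E_θ[U_n U_nᵀ] → I`. -/
structure IsLimitingFisherInfo (M : ModelClass ν g) (θ : EuclideanSpace ℝ (Fin g))
    (I : Matrix (Fin g) (Fin g) ℝ) : Prop where
  memLp_score : ∀ n i, MemLp (fun x => M.score n θ x i) 2 (M.law n θ)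
  tendsto : Tendsto (fun n : ℕ => (n : ℝ)⁻¹ • M.fisherInfo n θ) atTop (𝓝 I)

/-- The regularity conditions of maximum likelihood theory at the true parameter `θ₀`, with
limiting Fisher information `I`. -/
structure RegularAt (M : ModelClass ν g) (θ₀ : EuclideanSpace ℝ (Fin g))
    (I : Matrix (Fin g) (Fin g) ℝ) : Prop where
  /-- the densities have a common support -/
  common_support : ∀ n, ∀ᵐ x ∂(ν n), ∀ θ ∈ M.Θ, ∀ θ' ∈ M.Θ, 0 < M.f n θ x → 0 < M.f n θ' x
  /-- the densities are twice continuously differentiable in the parameter -/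
  contDiffOn : ∀ n, ∀ᵐ x ∂(ν n), ContDiffOn ℝ 2 (fun θ => M.f n θ x) M.Θ
  /-- the limiting Fisher information exists -/
  fisher : M.IsLimitingFisherInfo θ₀ I
  /-- the limiting Fisher information is positive definite -/
  posDef : I.PosDef
  /-- uniform law of large numbers for the observed information: uniformly in `θ` in a
  neighbourhood of `θ₀`, `(1/n) A_n(θ; X_n)` converges in probability, under the true parameter
  (`h = 0`) and under each local alternative `θ₀ + h/√n`, to a limit `J θ` which is continuous
  at `θ₀` with `J θ₀ = I` -/
  obsInfo_tendsto : ∃ (J : EuclideanSpace ℝ (Fin g) → Matrix (Fin g) (Fin g) ℝ),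
    ∃ W ∈ 𝓝 θ₀, ContinuousAt J θ₀ ∧ J θ₀ = I ∧
      ∀ h : EuclideanSpace ℝ (Fin g), ∀ ε : ℝ, 0 < ε →
        Tendsto (fun n : ℕ => M.law n (θ₀ + (√(n : ℝ))⁻¹ • h)
            {x | ∃ θ ∈ W ∩ M.Θ, ∃ i j, ε ≤ |(n : ℝ)⁻¹ * M.obsInfo n θ x i j - J θ i j|})
          atTop (𝓝 0)
  /-- asymptotic identifiability: every other parameter `θ` has a neighbourhood on which, with
  probability tending to one, all likelihoods are smaller than that of `θ₀` -/
  identifiable : ∀ θ ∈ M.Θ, θ ≠ θ₀ → ∃ V ∈ 𝓝 θ,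
    Tendsto (fun n : ℕ => M.law n θ₀ {x | ∃ θ' ∈ V ∩ M.Θ, M.f n θ₀ x ≤ M.f n θ' x})
      atTop (𝓝 0)
  /-- the same near the boundary of `Θ` and near infinity, that is, outside some compact set -/
  identifiable_compl : ∃ C ⊆ M.Θ, IsCompact C ∧
    Tendsto (fun n : ℕ => M.law n θ₀ {x | ∃ θ' ∈ M.Θ \ C, M.f n θ₀ x ≤ M.f n θ' x})
      atTop (𝓝 0)

/-- `θhat` is a sequence of maximum likelihood estimators under the true parameter `θ₀`:
measurable maps of the data into `Θ` which maximize the likelihood over `Θ` with probability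
tending to one (in particular, if they maximize it at every data point). -/
structure IsMLESeq (M : ModelClass ν g) (θ₀ : EuclideanSpace ℝ (Fin g))
    (θhat : (n : ℕ) → 𝒳 n → EuclideanSpace ℝ (Fin g)) : Prop where
  measurable : ∀ n, Measurable (θhat n)
  mem : ∀ n x, θhat n x ∈ M.Θ
  maximizes : Tendsto (fun n : ℕ => M.law n θ₀
      {x | ¬ IsMaxOn (fun θ => M.f n θ x) M.Θ (θhat n x)}) atTop (𝓝 0)

end ModelClass

end

/-! Without independence no central limit theorem for the score is at hand; normality is forced by
the fact that likelihood ratios integrate to one. Near `θ₀` the Hessian of the log-likelihood is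
close to `-n I`, so with `S n = D(logLik) θ₀ / √n` the log-likelihood ratio of `θ₀ + h/√n` against
`θ₀` is `S n h - hᵀIh/2 + o(1)` in probability (`RegularAt.tendsto_law_logLik_sub`). Consistency,
the vanishing gradient at an interior maximum and the same Hessian bound give `√n (τ(θhat) - τ(θ₀))
= S n h + o(1)` for `h = I⁻¹∇τ` (`IsMLESeq.tendsto_law_linearization`).

For this `h` and every real `t`, the log-likelihood ratio in direction `t h` is therefore `t T -
t²v/2 + o(1)`, where `T` is the statistic and `v = hᵀIh`. If these ratios lose no mass in the limit,
every weak limit of `T` satisfies `E exp(tT - t²v/2) = 1` for all `t`, which is the moment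
generating function of `N(0, v)`; tightness of `T` then gives convergence.

That no mass is lost is contiguity, proved in `RegularAt.exists_law_local_le`. Under the alternative
`h` the quadratic expansion is still valid, and it makes a large ratio of `h` against `0` entail a
large ratio of `2h` against `h`; the latter is rare by Markov's inequality. This is where the
Hessian condition under local alternatives enters. -/

/-! ### Truncated exponential moments and the Gaussian law. -/

/-- The slope of `exp` is at most `K` wherever it lies below the cap. This Lipschitz bound lets
closeness of exponents in probability pass to truncated expectations. -/
theorem min_exp_sub_min_exp_le (K a b : ℝ) (hK : 0 < K) :
    |min (Real.exp a) K - min (Real.exp b) K| ≤ K * |a - b| := by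
  wlog hab : b ≤ a generalizing a b
  · rw [abs_sub_comm, abs_sub_comm a b]; exact this b a (le_of_not_ge hab)
  have hmono : min (Real.exp b) K ≤ min (Real.exp a) K := by gcongr
  rw [abs_of_nonneg (by linarith), abs_of_nonneg (by linarith)]
  have h1 : 1 - (a - b) ≤ Real.exp (b - a) := by linarith [Real.add_one_le_exp (b - a)]
  have h2 : Real.exp a * Real.exp (b - a) = Real.exp b := by rw [← Real.exp_add]; congr 1; ring
  have hmin : min (Real.exp a) K * Real.exp (b - a) ≤ min (Real.exp b) K := by
    refine le_min ?_ ?_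
    · rw [← h2]; gcongr; exact min_le_left _ _
    · calc min (Real.exp a) K * Real.exp (b - a) ≤ K * 1 := by
            gcongr
            · exact min_le_right _ _
            · exact Real.exp_le_one_iff.2 (by linarith)
        _ = K := mul_one K
  have h0 : 0 ≤ min (Real.exp a) K := le_min (Real.exp_pos a).le hK.le
  nlinarith [min_le_right (Real.exp a) K, mul_le_mul_of_nonneg_left h1 h0]

/-- A probability measure on the line whose truncated exponential moments are close to those of
a centred Gaussian law is this Gaussian law. -/
theorem eq_gaussianReal_of_integral_min_exp (μ : Measure ℝ) [IsProbabilityMeasure μ] (v : ℝ≥0)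
    (hle : ∀ t K : ℝ, 0 < K → ∫ y, min (Real.exp (t * y - t ^ 2 * v / 2)) K ∂μ ≤ 1)
    (hge : ∀ t ε : ℝ, 0 < ε → ∃ K : ℝ, 0 < K ∧
      1 - ε ≤ ∫ y, min (Real.exp (t * y - t ^ 2 * v / 2)) K ∂μ) :
    μ = gaussianReal 0 v := by
  have hint (t K : ℝ) (hK : 0 < K) :
      Integrable (fun y => min (Real.exp (t * y - t ^ 2 * v / 2)) K) μ := by
    refine Integrable.of_bound (by fun_prop) K (ae_of_all _ fun y => ?_)
    rw [Real.norm_of_nonneg (le_min (Real.exp_pos _).le hK.le)]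
    exact min_le_right _ _
  -- Fatou along the caps `N + 1`, which are positive already at `N = 0`.
  have hlint (t : ℝ) : ∫⁻ y, ENNReal.ofReal (Real.exp (t * y - t ^ 2 * v / 2)) ∂μ ≤ 1 := by
    have hlim : ∀ y : ℝ, Tendsto (fun N : ℕ => ENNReal.ofReal
        (min (Real.exp (t * y - t ^ 2 * v / 2)) (N + 1 : ℝ))) atTop
        (𝓝 (ENNReal.ofReal (Real.exp (t * y - t ^ 2 * v / 2)))) := fun y => by
      refine tendsto_const_nhds.congr' ?_
      obtain ⟨N, hN⟩ := exists_nat_ge (Real.exp (t * y - t ^ 2 * v / 2))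
      filter_upwards [eventually_ge_atTop N] with n hn
      have : (N : ℝ) ≤ n := by exact_mod_cast hn
      rw [min_eq_left (by linarith)]
    calc ∫⁻ y, ENNReal.ofReal (Real.exp (t * y - t ^ 2 * v / 2)) ∂μ
        = ∫⁻ y, liminf (fun N : ℕ => ENNReal.ofReal
            (min (Real.exp (t * y - t ^ 2 * v / 2)) (N + 1 : ℝ))) atTop ∂μ :=
          lintegral_congr fun y => (hlim y).liminf_eq.symm
      _ ≤ liminf (fun N : ℕ => ∫⁻ y, ENNReal.ofReal
            (min (Real.exp (t * y - t ^ 2 * v / 2)) (N + 1 : ℝ)) ∂μ) atTop :=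
          lintegral_liminf_le fun N => by fun_prop
      _ ≤ liminf (fun _ : ℕ => (1 : ℝ≥0∞)) atTop := by
          refine liminf_le_liminf (Eventually.of_forall fun N => ?_)
          have hN : (0 : ℝ) < N + 1 := by positivity
          rw [← ofReal_integral_eq_lintegral_ofReal (hint t _ hN)
            (ae_of_all _ fun y => le_min (Real.exp_pos _).le hN.le)]
          exact ENNReal.ofReal_le_one.2 (hle t _ hN)
      _ = 1 := by simp
  have hexp (t : ℝ) : Integrable (fun y => Real.exp (t * y - t ^ 2 * v / 2)) μ := by
    refine ⟨by fun_prop, ?_⟩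
    rw [hasFiniteIntegral_iff_ofReal (ae_of_all _ fun y => (Real.exp_pos _).le)]
    exact (hlint t).trans_lt ENNReal.one_lt_top
  have hone (t : ℝ) : ∫ y, Real.exp (t * y - t ^ 2 * v / 2) ∂μ = 1 := by
    refine le_antisymm ?_ (le_of_forall_pos_sub_le fun ε hε => ?_)
    · have := ofReal_integral_eq_lintegral_ofReal (hexp t)
        (ae_of_all _ fun y => (Real.exp_pos _).le)
      rw [← ENNReal.ofReal_le_one, this]
      exact hlint t
    · obtain ⟨K, hK, hKε⟩ := hge t ε hε
      exact hKε.trans (integral_mono (hint t K hK) (hexp t) fun y => min_le_left _ _)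
  have hmul (t y : ℝ) : Real.exp (t * y) =
      Real.exp (t ^ 2 * v / 2) * Real.exp (t * y - t ^ 2 * v / 2) := by
    rw [← Real.exp_add]; congr 1; ring
  -- Finite exponential moments of every order let equality of the real moment generating functions
  -- extend to the complex ones, which determine the measure.
  have hset : integrableExpSet id μ = Set.univ := by
    refine Set.eq_univ_of_forall fun t => ?_
    change Integrable (fun y => Real.exp (t * y)) μ
    simp_rw [hmul t]
    exact (hexp t).const_mul _
  have hmgf : mgf id μ = mgf id (gaussianReal 0 v) := by
    ext t
    rw [congrFun mgf_id_gaussianReal t]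
    change ∫ y, Real.exp (t * y) ∂μ = _
    simp_rw [hmul t]
    rw [integral_const_mul, hone t, mul_one]
    congr 1; ring
  refine Measure.ext_of_complexMGF_id_eq ?_
  ext z
  exact eqOn_complexMGF_of_mgf hmgf (by simp [hset])

/-! ### Normal limits from local likelihood ratios. -/

section LikelihoodRatio

variable {Ω : ℕ → Type*} [∀ n, MeasurableSpace (Ω n)]

/-- Central limit theorem from local likelihood ratios: if, for every `t`, the exponentials of
`Λ t n` are uniformly integrable with limiting expectation one and `Λ t n` is asymptotically
`t T - t² v / 2`, then `T` converges in distribution to the centred Gaussian law. -/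
theorem tendstoInDistribution_gaussianReal_of_loglikelihood
    {μ : ∀ n, Measure (Ω n)} [∀ n, IsProbabilityMeasure (μ n)] {T : ∀ n, Ω n → ℝ}
    (hT : ∀ n, AEMeasurable (T n) (μ n)) {Λ : ℝ → ∀ n, Ω n → ℝ}
    (v : ℝ≥0)
    (hΛ : ∀ t, ∀ᶠ n in atTop, AEMeasurable (Λ t n) (μ n))
    (htight : ∀ ε : ℝ≥0∞, 0 < ε → ∃ R : ℝ, ∀ᶠ n in atTop, μ n {x | R < |T n x|} ≤ ε)
    (hconv : ∀ t ε : ℝ, 0 < ε →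
      Tendsto (fun n => μ n {x | ε ≤ |Λ t n x - (t * T n x - t ^ 2 * v / 2)|}) atTop (𝓝 0))
    (hle : ∀ t K : ℝ, 0 < K → ∀ᶠ n in atTop, ∫ x, min (Real.exp (Λ t n x)) K ∂(μ n) ≤ 1)
    (hge : ∀ t ε : ℝ, 0 < ε → ∃ K : ℝ, 0 < K ∧ ∀ᶠ n in atTop,
      1 - ε ≤ ∫ x, min (Real.exp (Λ t n x)) K ∂(μ n)) :
    TendstoInDistribution T atTop (id : ℝ → ℝ) μ (gaussianReal 0 v) := by
  refine ⟨hT, by fun_prop, ?_⟩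
  have hinst n : IsProbabilityMeasure ((μ n).map (T n)) := Measure.isProbabilityMeasure_map (hT n)
  set P : ℕ → ProbabilityMeasure ℝ := fun n => ⟨(μ n).map (T n), hinst n⟩ with hP
  have htightset : IsTightMeasureSet (Set.range fun n => (μ n).map (T n)) := by
    refine isTightMeasureSet_range_of_tendsto_limsup_measure_norm_gt ?_
    rw [ENNReal.tendsto_atTop_zero]
    intro ε hε
    obtain ⟨R, hR⟩ := htight ε hε
    refine ⟨R, fun r hr => limsup_le_of_le (by isBoundedDefault) ?_⟩
    filter_upwards [hR] with n hn
    rw [Measure.map_apply_of_aemeasurable (hT n) (measurableSet_lt (by fun_prop) (by fun_prop))]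
    refine (measure_mono fun x hx => ?_).trans hn
    exact lt_of_le_of_lt hr hx
  have hcomp : IsCompact (closure (Set.range P)) := by
    refine isCompact_closure_of_isTightMeasureSet (htightset.subset ?_)
    rintro _ ⟨_, ⟨n, rfl⟩, rfl⟩
    exact ⟨n, rfl⟩
  have htrunc (t K : ℝ) (hK : 0 < K) : Tendsto (fun n =>
      ∫ y, min (Real.exp (t * y - t ^ 2 * v / 2)) K ∂(P n : Measure ℝ)
        - ∫ x, min (Real.exp (Λ t n x)) K ∂(μ n)) atTop (𝓝 0) := by
    have hbd (u : ℝ) : ‖min (Real.exp u) K‖ ≤ K := by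
      rw [Real.norm_of_nonneg (le_min (Real.exp_pos _).le hK.le)]
      exact min_le_right _ _
    rw [Metric.tendsto_nhds]
    intro ε hε
    -- The good set contributes at most `K δ = ε/3`, and the bad set less than `δ K = ε/3`.
    set δ := ε / (3 * K) with hδ
    have hδ0 : 0 < δ := by positivity
    have hsmall : ∀ᶠ n in atTop,
        (μ n).real {x | δ ≤ |Λ t n x - (t * T n x - t ^ 2 * v / 2)|} < δ := by
      have := (ENNReal.tendsto_toReal ENNReal.zero_ne_top).comp (hconv t δ hδ0)
      exact this.eventually_lt_const (by simpa using hδ0)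
    filter_upwards [hsmall, hΛ t] with n hn hΛn
    have hi1 : Integrable (fun x => min (Real.exp (t * T n x - t ^ 2 * v / 2)) K) (μ n) := by
      have := hT n
      exact Integrable.of_bound (AEMeasurable.aestronglyMeasurable (by fun_prop)) K
        (ae_of_all _ fun x => hbd _)
    have hi2 : Integrable (fun x => min (Real.exp (Λ t n x)) K) (μ n) :=
      Integrable.of_bound (AEMeasurable.aestronglyMeasurable (by fun_prop)) K
        (ae_of_all _ fun x => hbd _)
    have hmap : ∫ y, min (Real.exp (t * y - t ^ 2 * v / 2)) K ∂(P n : Measure ℝ)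
        = ∫ x, min (Real.exp (t * T n x - t ^ 2 * v / 2)) K ∂(μ n) :=
      integral_map (hT n) (by fun_prop)
    rw [hmap, ← integral_sub hi1 hi2, Real.dist_eq, sub_zero]
    set s := {x | δ ≤ |Λ t n x - (t * T n x - t ^ 2 * v / 2)|} with hs
    have hsm : NullMeasurableSet s (μ n) := by
      have := hT n
      exact nullMeasurableSet_le (by fun_prop) (by fun_prop)
    have hpt : ∀ x, ‖min (Real.exp (t * T n x - t ^ 2 * v / 2)) K - min (Real.exp (Λ t n x)) K‖
        ≤ K * δ + s.indicator (fun _ => K) x := fun x => by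
      by_cases hx : x ∈ s
      · rw [Set.indicator_of_mem hx, Real.norm_eq_abs, abs_le]
        have h1 := min_le_right (Real.exp (t * T n x - t ^ 2 * v / 2)) K
        have h2 := min_le_right (Real.exp (Λ t n x)) K
        have h3 : 0 ≤ min (Real.exp (t * T n x - t ^ 2 * v / 2)) K :=
          le_min (Real.exp_pos _).le hK.le
        have h4 : 0 ≤ min (Real.exp (Λ t n x)) K := le_min (Real.exp_pos _).le hK.le
        have h5 : 0 ≤ K * δ := by positivity
        constructor <;> linarith
      · rw [Set.indicator_of_notMem hx, add_zero, Real.norm_eq_abs]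
        refine (min_exp_sub_min_exp_le K _ _ hK).trans ?_
        have : |Λ t n x - (t * T n x - t ^ 2 * v / 2)| < δ := not_le.1 hx
        rw [abs_sub_comm]
        gcongr
    have hind : Integrable (s.indicator fun _ => K) (μ n) :=
      (integrable_const K).indicator₀ hsm
    calc |∫ x, (min (Real.exp (t * T n x - t ^ 2 * v / 2)) K
            - min (Real.exp (Λ t n x)) K) ∂(μ n)|
        ≤ ∫ x, (K * δ + s.indicator (fun _ => K) x) ∂(μ n) :=
          norm_integral_le_of_norm_le ((integrable_const _).add hind) (ae_of_all _ hpt)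
      _ = K * δ + (μ n).real s * K := by
          rw [integral_add (integrable_const _) hind, integral_indicator₀ hsm]
          simp
      _ < ε := by
          have : K * δ = ε / 3 := by rw [hδ]; field_simp
          nlinarith
  have hlimit : Tendsto P atTop (𝓝 ⟨gaussianReal 0 v, inferInstance⟩) := by
    -- Prokhorov gives a limit `Q` along each ultrafilter; the truncated moments identify `Q` as the
    -- Gaussian law, so all these limits agree.
    rw [tendsto_iff_ultrafilter]
    intro U hU
    obtain ⟨Q, -, hQ⟩ := isCompact_iff_ultrafilter_le_nhds.1 hcomp (U.map P)
      (le_principal_iff.2 (mem_map.2 (Eventually.of_forall fun n => subset_closure ⟨n, rfl⟩)))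
    have hQ' : Tendsto P U (𝓝 Q) := hQ
    have hQint (t K : ℝ) (hK : 0 < K) : Tendsto (fun n =>
        ∫ x, min (Real.exp (Λ t n x)) K ∂(μ n)) U
        (𝓝 (∫ y, min (Real.exp (t * y - t ^ 2 * v / 2)) K ∂(Q : Measure ℝ))) := by
      let φ : BoundedContinuousFunction ℝ ℝ :=
        BoundedContinuousFunction.ofNormedAddCommGroup
          (fun y => min (Real.exp (t * y - t ^ 2 * v / 2)) K) (by fun_prop) K fun y => by
            rw [Real.norm_of_nonneg (le_min (Real.exp_pos _).le hK.le)]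
            exact min_le_right _ _
      have h1 := (ProbabilityMeasure.tendsto_iff_forall_integral_tendsto.1 hQ') φ
      have h2 := h1.sub ((htrunc t K hK).mono_left hU)
      simpa [φ] using h2
    have hQeq : (Q : Measure ℝ) = gaussianReal 0 v := by
      refine eq_gaussianReal_of_integral_min_exp _ v (fun t K hK => ?_) fun t ε hε => ?_
      · exact le_of_tendsto (hQint t K hK) (hU (hle t K hK))
      · obtain ⟨K, hK, hKn⟩ := hge t ε hε
        exact ⟨K, hK, ge_of_tendsto (hQint t K hK) (hU hKn)⟩
    have : Q = ⟨gaussianReal 0 v, inferInstance⟩ := Subtype.ext hQeq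
    rwa [← this]
  convert hlimit using 2
  simp

end LikelihoodRatio

/-! ### The information matrix as a bilinear form. -/

/-- The bilinear form on `ℝ^g` with matrix `I`. -/
noncomputable def euclideanBilin {g : ℕ} (I : Matrix (Fin g) (Fin g) ℝ) :
    EuclideanSpace ℝ (Fin g) →L[ℝ] EuclideanSpace ℝ (Fin g) →L[ℝ] ℝ :=
  ∑ i, ∑ j, I i j • (EuclideanSpace.proj i : EuclideanSpace ℝ (Fin g) →L[ℝ] ℝ).smulRight
    (EuclideanSpace.proj j : EuclideanSpace ℝ (Fin g) →L[ℝ] ℝ)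

section Bilin

variable {g : ℕ} (I : Matrix (Fin g) (Fin g) ℝ)

theorem euclideanBilin_apply (u w : EuclideanSpace ℝ (Fin g)) :
    euclideanBilin I u w = u.ofLp ⬝ᵥ (I *ᵥ w.ofLp) := by
  simp only [euclideanBilin, _root_.sum_apply, _root_.smul_apply,
    ContinuousLinearMap.smulRight_apply, PiLp.proj_apply, smul_eq_mul, dotProduct, mulVec,
    Finset.mul_sum]
  exact Finset.sum_congr rfl fun i _ => Finset.sum_congr rfl fun j _ => by ring

theorem euclideanBilin_single (i j : Fin g) :
    euclideanBilin I (EuclideanSpace.single i 1) (EuclideanSpace.single j 1) = I i j := by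
  simp [euclideanBilin_apply]

theorem EuclideanSpace.clm_apply_eq_sum {F : Type*} [NormedAddCommGroup F] [NormedSpace ℝ F]
    (T : EuclideanSpace ℝ (Fin g) →L[ℝ] F) (u : EuclideanSpace ℝ (Fin g)) :
    T u = ∑ i, u i • T (EuclideanSpace.single i 1) := by
  conv_lhs => rw [← (EuclideanSpace.basisFun (Fin g) ℝ).sum_repr u]
  simp

theorem norm_bilin_le_of_entries {ε : ℝ} (hε : 0 ≤ ε)
    (T : EuclideanSpace ℝ (Fin g) →L[ℝ] EuclideanSpace ℝ (Fin g) →L[ℝ] ℝ)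
    (hT : ∀ i j, |T (EuclideanSpace.single i 1) (EuclideanSpace.single j 1)| ≤ ε) :
    ‖T‖ ≤ g ^ 2 * ε := by
  refine ContinuousLinearMap.opNorm_le_bound₂ _ (by positivity) fun u w => ?_
  have hexp : T u w = ∑ i, ∑ j, u i * (w j *
      T (EuclideanSpace.single i 1) (EuclideanSpace.single j 1)) := by
    rw [EuclideanSpace.clm_apply_eq_sum T u, _root_.sum_apply]
    refine Finset.sum_congr rfl fun i _ => ?_
    rw [_root_.smul_apply, EuclideanSpace.clm_apply_eq_sum (T _) w, smul_eq_mul,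
      Finset.mul_sum]
    simp
  rw [hexp]
  calc ‖∑ i, ∑ j, u i * (w j * T (EuclideanSpace.single i 1) (EuclideanSpace.single j 1))‖
      ≤ ∑ i : Fin g, ∑ j : Fin g, ‖u‖ * (‖w‖ * ε) := by
        refine norm_sum_le_of_le _ fun i _ => norm_sum_le_of_le _ fun j _ => ?_
        rw [norm_mul, norm_mul]
        gcongr
        · exact PiLp.norm_apply_le u i
        · exact PiLp.norm_apply_le w j
        · exact hT i j
    _ = g ^ 2 * ε * ‖u‖ * ‖w‖ := by
        simp only [Finset.sum_const, Finset.card_univ, Fintype.card_fin, nsmul_eq_mul]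
        ring

theorem norm_clm_le_sqrt_sum (T : EuclideanSpace ℝ (Fin g) →L[ℝ] ℝ) :
    ‖T‖ ≤ √(∑ i, T (EuclideanSpace.single i 1) ^ 2) := by
  refine ContinuousLinearMap.opNorm_le_bound _ (Real.sqrt_nonneg _) fun u => ?_
  rw [EuclideanSpace.clm_apply_eq_sum T u, EuclideanSpace.norm_eq, mul_comm]
  simp only [smul_eq_mul, Real.norm_eq_abs, sq_abs]
  refine abs_le.2 ⟨?_, Real.sum_mul_le_sqrt_mul_sqrt _ _ _⟩
  have := Real.sum_mul_le_sqrt_mul_sqrt Finset.univ (fun i => - u i)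
    (fun i => T (EuclideanSpace.single i 1))
  simp only [neg_sq, neg_mul, Finset.sum_neg_distrib] at this
  linarith

variable {I}

theorem euclideanBilin_symm (hI : I.IsSymm) (u w : EuclideanSpace ℝ (Fin g)) :
    euclideanBilin I u w = euclideanBilin I w u := by
  rw [euclideanBilin_apply, euclideanBilin_apply, dotProduct_mulVec, ← mulVec_transpose, hI.eq,
    dotProduct_comm]

/-- Positive definiteness makes the map injective, and an injective linear map in finite dimension
is bounded below. -/
theorem exists_norm_le_euclideanBilin (hI : I.PosDef) :
    ∃ c : ℝ, 0 < c ∧ ∀ u, c * ‖u‖ ≤ ‖euclideanBilin I u‖ := by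
  have hker : (euclideanBilin I).toLinearMap.ker = ⊥ := by
    refine LinearMap.ker_eq_bot'.2 fun u hu => ?_
    by_contra hne
    have hpos := hI.dotProduct_mulVec_pos (x := u.ofLp) (by simpa using hne)
    have h0 : euclideanBilin I u u = 0 := by
      have : euclideanBilin I u = 0 := hu
      rw [this]; rfl
    rw [euclideanBilin_apply] at h0
    simp only [star_trivial] at hpos
    exact hpos.ne' h0
  obtain ⟨K, hK, hanti⟩ := LinearMap.exists_antilipschitzWith _ hker
  refine ⟨(K : ℝ)⁻¹, by positivity, fun u => ?_⟩
  have := hanti.le_mul_dist u 0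
  simp only [dist_zero_right, map_zero] at this
  rw [inv_mul_le_iff₀ (by positivity)]
  exact this

end Bilin

/-! ### Second-order expansion. -/

section Taylor

variable {E : Type*} [NormedAddCommGroup E] [NormedSpace ℝ E]

/-- Quadratic expansion of a function whose second derivative is close to the constant `-n B`. -/
theorem quadratic_expansion {φ : E → ℝ} {Θ : Set E} (hΘ : IsOpen Θ) (hφ : ContDiffOn ℝ 2 φ Θ)
    {B : E →L[ℝ] E →L[ℝ] ℝ} (hB : ∀ u w, B u w = B w u) {θ₀ : E} {r a η : ℝ}
    (hball : Metric.ball θ₀ r ⊆ Θ)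
    (hbd : ∀ θ ∈ Metric.ball θ₀ r, ‖fderiv ℝ (fderiv ℝ φ) θ + a • B‖ ≤ η)
    {θ : E} (hθ : θ ∈ Metric.ball θ₀ r) :
    ‖fderiv ℝ φ θ - fderiv ℝ φ θ₀ + a • B (θ - θ₀)‖ ≤ η * ‖θ - θ₀‖ ∧
    |φ θ - φ θ₀ - fderiv ℝ φ θ₀ (θ - θ₀) + a / 2 * B (θ - θ₀) (θ - θ₀)| ≤ η * ‖θ - θ₀‖ ^ 2 := by
  have hd : ∀ θ ∈ Θ, HasFDerivAt φ (fderiv ℝ φ θ) θ := fun θ hθ =>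
    ((hφ.contDiffAt (hΘ.mem_nhds hθ)).differentiableAt (by norm_num)).hasFDerivAt
  have hdd : ∀ θ ∈ Θ, HasFDerivAt (fderiv ℝ φ) (fderiv ℝ (fderiv ℝ φ) θ) θ := fun θ hθ =>
    (((hφ.contDiffAt (hΘ.mem_nhds hθ)).fderiv_right (m := 1)
      (by norm_num)).differentiableAt (by norm_num)).hasFDerivAt
  -- Mean value inequality for `Dφ + a B`, whose derivative is the quantity bounded by `η`.
  have key : ∀ θ ∈ Metric.ball θ₀ r,
      ‖fderiv ℝ φ θ - fderiv ℝ φ θ₀ + a • B (θ - θ₀)‖ ≤ η * ‖θ - θ₀‖ := fun θ hθ => by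
    have h0 : θ₀ ∈ Metric.ball θ₀ r := Metric.mem_ball_self (Metric.pos_of_mem_ball hθ)
    have := (convex_ball θ₀ r).norm_image_sub_le_of_norm_hasFDerivWithin_le
      (f := fun θ => fderiv ℝ φ θ + a • B θ)
      (fun x hx => ((hdd x (hball hx)).add ((B.hasFDerivAt).const_smul a)).hasFDerivWithinAt)
      hbd h0 hθ
    have heq : fderiv ℝ φ θ - fderiv ℝ φ θ₀ + a • B (θ - θ₀)
        = fderiv ℝ φ θ + a • B θ - (fderiv ℝ φ θ₀ + a • B θ₀) := by
      rw [map_sub, smul_sub]; abel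
    rwa [heq]
  refine ⟨key θ hθ, ?_⟩
  set ρ := ‖θ - θ₀‖ with hρ
  have hη : 0 ≤ η := (ContinuousLinearMap.opNorm_nonneg _).trans (hbd θ hθ)
  have hsub : ∀ x ∈ segment ℝ θ₀ θ, x ∈ Metric.ball θ₀ r ∧ ‖x - θ₀‖ ≤ ρ := fun x hx => by
    have h0 : θ₀ ∈ Metric.ball θ₀ r := Metric.mem_ball_self (Metric.pos_of_mem_ball hθ)
    exact ⟨(convex_ball θ₀ r).segment_subset h0 hθ hx, norm_sub_le_of_mem_segment hx⟩
  -- The derivative of the quadratic remainder is the quantity bounded by `key`; symmetry of `B`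
  -- merges the two terms of the product rule.
  have hder : ∀ x ∈ segment ℝ θ₀ θ, HasFDerivWithinAt
      (fun x => φ x - fderiv ℝ φ θ₀ (x - θ₀) + a / 2 * B (x - θ₀) (x - θ₀))
      (fderiv ℝ φ x - fderiv ℝ φ θ₀ + a • B (x - θ₀)) (segment ℝ θ₀ θ) x := fun x hx => by
    have hid : HasFDerivAt (fun x => x - θ₀) (ContinuousLinearMap.id ℝ E) x :=
      (hasFDerivAt_id x).sub_const θ₀
    have h1 := (hd x (hball (hsub x hx).1)).sub ((fderiv ℝ φ θ₀).hasFDerivAt.comp x hid)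
    have h2 : HasFDerivAt (fun x => B (x - θ₀) (x - θ₀)) _ x :=
      (B.hasFDerivAt.comp x hid).clm_apply hid
    refine ((h1.add (h2.const_mul (a / 2))).congr_fderiv ?_).hasFDerivWithinAt
    ext w
    simp only [_root_.add_apply, _root_.sub_apply,
      _root_.smul_apply, ContinuousLinearMap.comp_apply,
      ContinuousLinearMap.flip_apply, ContinuousLinearMap.id_apply, Function.comp_apply, smul_eq_mul, hB w (x - θ₀)]
    ring
  have := (convex_segment θ₀ θ).norm_image_sub_le_of_norm_hasFDerivWithin_le hder
    (C := η * ρ) (fun x hx => (key x (hsub x hx).1).trans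
      (mul_le_mul_of_nonneg_left (hsub x hx).2 hη))
    (left_mem_segment ℝ θ₀ θ) (right_mem_segment ℝ θ₀ θ)
  rw [Real.norm_eq_abs] at this
  simp only [sub_self, map_zero, mul_zero, add_zero, sub_zero] at this
  rw [pow_two, ← mul_assoc]
  convert this using 2
  ring

end Taylor

/-! ### Vanishing outer probabilities, by monotonicity and subadditivity only. -/

section OuterMeasure

variable {Ω : ℕ → Type*} [∀ n, MeasurableSpace (Ω n)] {μ : ∀ n, Measure (Ω n)}

theorem tendsto_measure_zero_of_eventually_subset {s t : ∀ n, Set (Ω n)}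
    (ht : Tendsto (fun n => μ n (t n)) atTop (𝓝 0)) (h : ∀ᶠ n in atTop, s n ⊆ t n) :
    Tendsto (fun n => μ n (s n)) atTop (𝓝 0) :=
  tendsto_of_tendsto_of_tendsto_of_le_of_le' tendsto_const_nhds ht
    (Eventually.of_forall fun _ => zero_le) (h.mono fun _ hn => measure_mono hn)

theorem tendsto_measure_union_zero {s t : ∀ n, Set (Ω n)}
    (hs : Tendsto (fun n => μ n (s n)) atTop (𝓝 0))
    (ht : Tendsto (fun n => μ n (t n)) atTop (𝓝 0)) :
    Tendsto (fun n => μ n (s n ∪ t n)) atTop (𝓝 0) :=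
  tendsto_of_tendsto_of_tendsto_of_le_of_le tendsto_const_nhds (by simpa using hs.add ht)
    (fun _ => zero_le) (fun _ => measure_union_le _ _)

end OuterMeasure

/-! ### The log-likelihood near the true parameter. -/

namespace ModelClass

variable {𝒳 : ℕ → Type*} [∀ n, MeasurableSpace (𝒳 n)] {ν : ∀ n, Measure (𝒳 n)} {g : ℕ}
  {M : ModelClass ν g} {θ₀ : EuclideanSpace ℝ (Fin g)} {I : Matrix (Fin g) (Fin g) ℝ}

theorem law_absolutelyContinuous (M : ModelClass ν g) (n : ℕ) (θ : EuclideanSpace ℝ (Fin g)) :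
    M.law n θ ≪ ν n :=
  withDensity_absolutelyContinuous _ _

theorem tendsto_local (θ₀ h : EuclideanSpace ℝ (Fin g)) :
    Tendsto (fun n : ℕ => θ₀ + (√(n : ℝ))⁻¹ • h) atTop (𝓝 θ₀) := by
  have h1 : Tendsto (fun n : ℕ => (√(n : ℝ))⁻¹) atTop (𝓝 0) :=
    tendsto_inv_atTop_zero.comp (Real.tendsto_sqrt_atTop.comp tendsto_natCast_atTop_atTop)
  simpa using (h1.smul_const h).const_add θ₀

theorem eventually_local_mem (hθ₀ : θ₀ ∈ M.Θ) (h : EuclideanSpace ℝ (Fin g)) :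
    ∀ᶠ n : ℕ in atTop, θ₀ + (√(n : ℝ))⁻¹ • h ∈ M.Θ :=
  tendsto_local θ₀ h (M.isOpen_Θ.mem_nhds hθ₀)

theorem RegularAt.ae_pos (hreg : M.RegularAt θ₀ I) (n : ℕ) {θ : EuclideanSpace ℝ (Fin g)}
    (hθ : θ ∈ M.Θ) : ∀ᵐ x ∂(M.law n θ), ∀ θ' ∈ M.Θ, 0 < M.f n θ' x := by
  rw [law, ae_withDensity_iff (M.measurable_f n θ hθ).ennreal_ofReal]
  filter_upwards [hreg.common_support n] with x hx hne θ' hθ'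
  refine hx θ hθ θ' hθ' ?_
  simpa using hne

/-- The likelihood is positive and its logarithm is `C²` with Hessian close to `-n I` near `θ₀`. -/
structure QuadraticNear (M : ModelClass ν g) (θ₀ : EuclideanSpace ℝ (Fin g))
    (I : Matrix (Fin g) (Fin g) ℝ) (η r : ℝ) (n : ℕ) (x : 𝒳 n) : Prop where
  pos : ∀ θ ∈ M.Θ, 0 < M.f n θ x
  contDiffOn : ContDiffOn ℝ 2 (M.logLik n x) M.Θ
  hess : ∀ θ ∈ Metric.ball θ₀ r,
    ‖fderiv ℝ (fderiv ℝ (M.logLik n x)) θ + (n : ℝ) • euclideanBilin I‖ ≤ n * η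

theorem RegularAt.exists_quadraticNear (hreg : M.RegularAt θ₀ I) (hθ₀ : θ₀ ∈ M.Θ) {η : ℝ}
    (hη : 0 < η) : ∃ r > 0, Metric.ball θ₀ r ⊆ M.Θ ∧ ∀ h : EuclideanSpace ℝ (Fin g),
      Tendsto (fun n : ℕ => M.law n (θ₀ + (√(n : ℝ))⁻¹ • h)
        {x | ¬ M.QuadraticNear θ₀ I η r n x}) atTop (𝓝 0) := by
  obtain ⟨J, W, hW, hJc, hJ, hconv⟩ := hreg.obsInfo_tendsto
  -- Each Hessian entry errs by at most `2nε`: one `ε` from the observed information to `J`, one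
  -- from `J` to `I`. Passing to the operator norm costs `g²`, and the `+ 1` covers `g = 0`.
  set ε : ℝ := η / (2 * g ^ 2 + 1) with hε
  have hε0 : 0 < ε := by positivity
  have hJn : ∀ᶠ θ in 𝓝 θ₀, ∀ i j, |J θ i j - I i j| < ε := by
    refine eventually_all.2 fun i => eventually_all.2 fun j => ?_
    have h1 : Tendsto (fun θ => J θ i j) (𝓝 θ₀) (𝓝 (I i j)) := by
      have := (tendsto_pi_nhds.1 ((tendsto_pi_nhds.1 hJc) i)) j
      rwa [hJ] at this
    exact Metric.tendsto_nhds.1 h1 ε hε0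
  obtain ⟨r, hr, hball⟩ := Metric.mem_nhds_iff.1
    (inter_mem (inter_mem hW (M.isOpen_Θ.mem_nhds hθ₀)) hJn)
  refine ⟨r, hr, fun θ hθ => (hball hθ).1.2, fun h => ?_⟩
  have hnull : ∀ᶠ n : ℕ in atTop, M.law n (θ₀ + (√(n : ℝ))⁻¹ • h)
      {x | ¬ ((∀ θ ∈ M.Θ, 0 < M.f n θ x) ∧ ContDiffOn ℝ 2 (fun θ => M.f n θ x) M.Θ)} = 0 := by
    filter_upwards [eventually_local_mem hθ₀ h] with n hn
    exact (hreg.ae_pos n hn).and ((M.law_absolutelyContinuous n _).ae_le (hreg.contDiffOn n))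
  refine tendsto_measure_zero_of_eventually_subset
    (tendsto_measure_union_zero (tendsto_const_nhds.congr' (hnull.mono fun n hn => hn.symm))
      (hconv h ε hε0)) ?_
  filter_upwards [eventually_gt_atTop 0] with n hn x hx
  by_contra hcon
  rw [Set.mem_union, not_or] at hcon
  obtain ⟨h1, h2⟩ := hcon
  simp only [Set.mem_ofPred_eq, not_not] at h1
  refine hx ⟨h1.1, h1.2.log fun θ hθ => (h1.1 θ hθ).ne', fun θ hθ => ?_⟩
  have hn' : (0 : ℝ) < n := by exact_mod_cast hn
  have hent : ∀ i j, |(fderiv ℝ (fderiv ℝ (M.logLik n x)) θ + (n : ℝ) • euclideanBilin I)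
      (EuclideanSpace.single i 1) (EuclideanSpace.single j 1)| ≤ 2 * n * ε := fun i j => by
    have hA : |(n : ℝ)⁻¹ * M.obsInfo n θ x i j - J θ i j| < ε := by
      by_contra hc
      exact h2 ⟨θ, (hball hθ).1, i, j, not_lt.1 hc⟩
    have hJ' := (hball hθ).2 i j
    have hval : (fderiv ℝ (fderiv ℝ (M.logLik n x)) θ + (n : ℝ) • euclideanBilin I)
        (EuclideanSpace.single i 1) (EuclideanSpace.single j 1)
        = -(n * (((n : ℝ)⁻¹ * M.obsInfo n θ x i j - J θ i j) + (J θ i j - I i j))) := by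
      simp only [_root_.add_apply, _root_.smul_apply, euclideanBilin_single, smul_eq_mul,
        obsInfo, hessMat, Matrix.neg_apply, Matrix.of_apply]
      field_simp
      ring
    rw [hval, abs_neg, abs_mul, abs_of_pos hn']
    have := abs_add_le ((n : ℝ)⁻¹ * M.obsInfo n θ x i j - J θ i j) (J θ i j - I i j)
    calc _ ≤ (n : ℝ) * (2 * ε) := by gcongr; linarith
      _ = 2 * n * ε := by ring
  refine (norm_bilin_le_of_entries (by positivity) _ hent).trans ?_
  have : (2 * (g : ℝ) ^ 2) * ε ≤ η := by
    rw [hε, mul_div_assoc', div_le_iff₀ (by positivity)]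
    nlinarith
  calc (g : ℝ) ^ 2 * (2 * n * ε) = n * ((2 * (g : ℝ) ^ 2) * ε) := by ring
    _ ≤ n * η := by gcongr

/-- At scale `1/√n` the factor `n` in the Hessian cancels, so the error bound is free of `n`. -/
theorem QuadraticNear.local_expansion {η r : ℝ} {n : ℕ} {x : 𝒳 n}
    (hx : M.QuadraticNear θ₀ I η r n x) (hI : I.IsSymm) (hball : Metric.ball θ₀ r ⊆ M.Θ)
    (hn : 0 < n) {h : EuclideanSpace ℝ (Fin g)}
    (hh : θ₀ + (√(n : ℝ))⁻¹ • h ∈ Metric.ball θ₀ r) :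
    |M.logLik n x (θ₀ + (√(n : ℝ))⁻¹ • h) - M.logLik n x θ₀
      - ((√(n : ℝ))⁻¹ * fderiv ℝ (M.logLik n x) θ₀ h - euclideanBilin I h h / 2)|
      ≤ η * ‖h‖ ^ 2 := by
  have hn' : (0 : ℝ) < n := by exact_mod_cast hn
  have hsq : (n : ℝ) * ((√(n : ℝ))⁻¹ * (√(n : ℝ))⁻¹) = 1 := by
    rw [← mul_inv, Real.mul_self_sqrt hn'.le, mul_inv_cancel₀ hn'.ne']
  have := (quadratic_expansion M.isOpen_Θ hx.contDiffOn (euclideanBilin_symm hI) hball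
    hx.hess hh).2
  rw [add_sub_cancel_left] at this
  simp only [map_smul, _root_.smul_apply, smul_eq_mul, norm_smul, mul_pow, norm_inv,
    Real.norm_of_nonneg (Real.sqrt_nonneg _)] at this
  convert this using 1
  · congr 1
    linear_combination (-(euclideanBilin I h h / 2)) * hsq
  · linear_combination (-(η * ‖h‖ ^ 2)) * hsq

/-! ### Truncated likelihood ratios and contiguity. -/

/-- Change of measure to `ν n`; common support settles the points where the density at `θ₀`
vanishes. -/
theorem lintegral_ofReal_min (hreg : M.RegularAt θ₀ I) (n : ℕ) (hθ₀ : θ₀ ∈ M.Θ)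
    {θ : EuclideanSpace ℝ (Fin g)} (hθ : θ ∈ M.Θ) {K : ℝ} (hK : 0 < K) :
    ENNReal.ofReal (∫ x, min (Real.exp (M.logLik n x θ - M.logLik n x θ₀)) K ∂(M.law n θ₀))
      = ∫⁻ x, ENNReal.ofReal (min (M.f n θ x) (K * M.f n θ₀ x)) ∂(ν n) := by
  have hf := M.measurable_f n θ hθ
  have hf₀ := M.measurable_f n θ₀ hθ₀
  have : IsProbabilityMeasure (M.law n θ₀) := M.isProbabilityMeasure_law n ⟨θ₀, hθ₀⟩
  have hmeas : Measurable fun x => min (Real.exp (M.logLik n x θ - M.logLik n x θ₀)) K := by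
    unfold logLik; fun_prop
  rw [ofReal_integral_eq_lintegral_ofReal
    (Integrable.of_bound hmeas.aestronglyMeasurable K (ae_of_all _ fun x => ?_))
    (ae_of_all _ fun x => le_min (Real.exp_pos _).le hK.le), law,
    lintegral_withDensity_eq_lintegral_mul _ hf₀.ennreal_ofReal hmeas.ennreal_ofReal]
  · refine lintegral_congr_ae ?_
    filter_upwards [hreg.common_support n] with x hx
    rw [Pi.mul_apply, ← ENNReal.ofReal_mul (M.f_nonneg n θ₀ hθ₀ x)]
    congr 1
    rcases (M.f_nonneg n θ₀ hθ₀ x).eq_or_lt' with h0 | h0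
    · have h1 : M.f n θ x = 0 := by
        by_contra hne
        exact (hx θ hθ θ₀ hθ₀ ((M.f_nonneg n θ hθ x).lt_of_ne' hne)).ne' h0
      simp [h0, h1]
    · have h1 := hx θ₀ hθ₀ θ hθ h0
      rw [logLik, logLik, Real.exp_sub, Real.exp_log h0, Real.exp_log h1,
        mul_min_of_nonneg _ _ h0.le, mul_div_cancel₀ _ h0.ne', mul_comm K]
  · rw [Real.norm_of_nonneg (le_min (Real.exp_pos _).le hK.le)]
    exact min_le_right _ _

theorem integral_min_likelihoodRatio_le (hreg : M.RegularAt θ₀ I) (n : ℕ) (hθ₀ : θ₀ ∈ M.Θ)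
    {θ : EuclideanSpace ℝ (Fin g)} (hθ : θ ∈ M.Θ) {K : ℝ} (hK : 0 < K) :
    ∫ x, min (Real.exp (M.logLik n x θ - M.logLik n x θ₀)) K ∂(M.law n θ₀) ≤ 1 := by
  rw [← ENNReal.ofReal_le_one, lintegral_ofReal_min hreg n hθ₀ hθ hK, ← M.lintegral_f n θ hθ]
  exact lintegral_mono fun x => ENNReal.ofReal_le_ofReal (min_le_left _ _)

/-- Truncation loses at most the mass that `θ` puts where the ratio exceeds `K`. -/
theorem le_integral_min_likelihoodRatio (hreg : M.RegularAt θ₀ I) (n : ℕ) (hθ₀ : θ₀ ∈ M.Θ)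
    {θ : EuclideanSpace ℝ (Fin g)} (hθ : θ ∈ M.Θ) {K ε : ℝ} (hK : 0 < K) (hε : 0 ≤ ε)
    (htail : M.law n θ {x | K * M.f n θ₀ x < M.f n θ x} ≤ ENNReal.ofReal ε) :
    1 - ε ≤ ∫ x, min (Real.exp (M.logLik n x θ - M.logLik n x θ₀)) K ∂(M.law n θ₀) := by
  have hf := M.measurable_f n θ hθ
  have hf₀ := M.measurable_f n θ₀ hθ₀
  have hnonneg : 0 ≤ ∫ x, min (Real.exp (M.logLik n x θ - M.logLik n x θ₀)) K ∂(M.law n θ₀) :=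
    integral_nonneg fun x => le_min (Real.exp_pos _).le hK.le
  have hs : MeasurableSet {x | K * M.f n θ₀ x < M.f n θ x} :=
    measurableSet_lt (by fun_prop) hf
  rw [sub_le_iff_le_add, ← ENNReal.ofReal_le_ofReal_iff (by positivity),
    ENNReal.ofReal_add hnonneg hε, lintegral_ofReal_min hreg n hθ₀ hθ hK, ENNReal.ofReal_one,
    ← M.lintegral_f n θ hθ]
  refine le_trans ?_ (add_le_add le_rfl htail)
  rw [law, withDensity_apply _ hs, ← lintegral_indicator hs,
    ← lintegral_add_left (by fun_prop)]
  refine lintegral_mono fun x => ?_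
  by_cases hx : K * M.f n θ₀ x < M.f n θ x
  · rw [Set.indicator_of_mem (show x ∈ {x | K * M.f n θ₀ x < M.f n θ x} from hx)]
    exact le_add_self
  · rw [min_eq_left (not_lt.1 hx)]
    exact le_self_add

/-- Markov's inequality for the likelihood ratio. -/
theorem law_lt_le (M : ModelClass ν g) (n : ℕ) {θ θ' : EuclideanSpace ℝ (Fin g)}
    (hθ : θ ∈ M.Θ) (hθ' : θ' ∈ M.Θ) {k : ℝ} (hk : 0 < k) :
    M.law n θ {x | k * M.f n θ x < M.f n θ' x} ≤ ENNReal.ofReal k⁻¹ := by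
  have hf := M.measurable_f n θ hθ
  have hf' := M.measurable_f n θ' hθ'
  have hs : MeasurableSet {x | k * M.f n θ x < M.f n θ' x} :=
    measurableSet_lt (by fun_prop) hf'
  rw [law, withDensity_apply _ hs]
  calc ∫⁻ x in {x | k * M.f n θ x < M.f n θ' x}, ENNReal.ofReal (M.f n θ x) ∂(ν n)
      ≤ ∫⁻ x in {x | k * M.f n θ x < M.f n θ' x},
          ENNReal.ofReal k⁻¹ * ENNReal.ofReal (M.f n θ' x) ∂(ν n) := by
        refine setLIntegral_mono (by fun_prop) fun x hx => ?_
        rw [← ENNReal.ofReal_mul (by positivity)]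
        refine ENNReal.ofReal_le_ofReal ?_
        rw [← div_eq_inv_mul, le_div_iff₀ hk, mul_comm]
        exact (le_of_lt hx)
    _ ≤ ∫⁻ x, ENNReal.ofReal k⁻¹ * ENNReal.ofReal (M.f n θ' x) ∂(ν n) :=
        setLIntegral_le_lintegral _ _
    _ = ENNReal.ofReal k⁻¹ := by
        rw [lintegral_const_mul _ (by fun_prop), M.lintegral_f n θ' hθ', mul_one]

/-- The likelihood ratios of local alternatives are bounded in probability under these
alternatives. -/
theorem RegularAt.exists_law_local_le (hreg : M.RegularAt θ₀ I) (hθ₀ : θ₀ ∈ M.Θ)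
    (h : EuclideanSpace ℝ (Fin g)) {ε : ℝ} (hε : 0 < ε) :
    ∃ K : ℝ, 0 < K ∧ ∀ᶠ n : ℕ in atTop, M.law n (θ₀ + (√(n : ℝ))⁻¹ • h)
      {x | K * M.f n θ₀ x < M.f n (θ₀ + (√(n : ℝ))⁻¹ • h) x} ≤ ENNReal.ofReal ε := by
  obtain ⟨r, hr, hball, hgood⟩ := hreg.exists_quadraticNear hθ₀ one_pos
  have hsymm : I.IsSymm := by simpa [Matrix.IsSymm, Matrix.IsHermitian] using hreg.posDef.isHermitian
  set q := euclideanBilin I h h with hq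
  -- With `L₁`, `L₂` the log-ratios of `h`, `2h` against `0`, the score cancels in `L₂ - 2 L₁`,
  -- leaving `-q` with error at most `(4 + 2)‖h‖²`. Hence `L₂ - L₁ ≥ L₁ - c`.
  set c : ℝ := q + 6 * ‖h‖ ^ 2 with hc
  set k : ℝ := 2 / ε with hk
  have hk0 : 0 < k := by positivity
  refine ⟨k * Real.exp c, by positivity, ?_⟩
  have hnear (u : EuclideanSpace ℝ (Fin g)) :=
    (tendsto_local θ₀ u).eventually (Metric.ball_mem_nhds θ₀ hr)
  filter_upwards [eventually_gt_atTop 0, hnear h, hnear ((2 : ℝ) • h),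
    (hgood h).eventually_le_const (ENNReal.ofReal_pos.2 (half_pos hε))] with n hn h1 h2 hbad
  have hsub : {x | k * Real.exp c * M.f n θ₀ x < M.f n (θ₀ + (√(n : ℝ))⁻¹ • h) x} ⊆
      {x | ¬ M.QuadraticNear θ₀ I 1 r n x} ∪
      {x | k * M.f n (θ₀ + (√(n : ℝ))⁻¹ • h) x
        < M.f n (θ₀ + (√(n : ℝ))⁻¹ • (2 : ℝ) • h) x} := fun x hx => by
    by_contra hcon
    rw [Set.mem_union, not_or] at hcon
    obtain ⟨hg, hlt⟩ := hcon
    simp only [Set.mem_ofPred_eq, not_not, not_lt] at hg hlt hx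
    have e1 := abs_le.1 (hg.local_expansion hsymm hball hn h1)
    have e2 := abs_le.1 (hg.local_expansion hsymm hball hn h2)
    simp only [map_smul, _root_.smul_apply, smul_eq_mul, norm_smul, Real.norm_ofNat,
      ← hq] at e1 e2
    have p0 := hg.pos _ hθ₀
    have p1 := hg.pos _ (hball h1)
    have p2 := hg.pos _ (hball h2)
    have l1 := Real.log_lt_log (by positivity) hx
    have l2 := Real.log_le_log p2 hlt
    rw [Real.log_mul (by positivity) p0.ne', Real.log_mul hk0.ne' (Real.exp_pos c).ne',
      Real.log_exp] at l1
    rw [Real.log_mul hk0.ne' p1.ne'] at l2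
    simp only [logLik] at e1 e2
    linarith [e1.1, e1.2, e2.1, e2.2]
  calc _ ≤ _ := measure_mono hsub
    _ ≤ _ := measure_union_le _ _
    _ ≤ ENNReal.ofReal (ε / 2) + ENNReal.ofReal k⁻¹ :=
        add_le_add hbad (M.law_lt_le n (hball h1) (hball h2) hk0)
    _ = ENNReal.ofReal ε := by
        rw [← ENNReal.ofReal_add (by positivity) (by positivity)]
        congr 1
        rw [hk, inv_div]; ring

/-! ### Tightness of the score, and consistency. -/

/-- The mean of the squared score norm over `n` is the trace of the normalized Fisher information,
which converges; Markov's inequality then applies. -/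
theorem RegularAt.exists_law_norm_score_le (hreg : M.RegularAt θ₀ I) (hθ₀ : θ₀ ∈ M.Θ)
    {ε : ℝ≥0∞} (hε : 0 < ε) :
    ∃ R : ℝ, 0 < R ∧ ∀ᶠ n : ℕ in atTop, M.law n θ₀
      {x | R < (√(n : ℝ))⁻¹ * ‖fderiv ℝ (M.logLik n x) θ₀‖} ≤ ε := by
  set Z : ∀ n, 𝒳 n → ℝ := fun n x => (n : ℝ)⁻¹ * ∑ i, M.score n θ₀ x i ^ 2 with hZ
  have hsq (n : ℕ) (i : Fin g) : Integrable (fun x => M.score n θ₀ x i ^ 2) (M.law n θ₀) :=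
    (hreg.fisher.memLp_score n i).integrable_sq
  have hZint (n : ℕ) : Integrable (Z n) (M.law n θ₀) :=
    (integrable_finsetSum _ fun i _ => hsq n i).const_mul _
  have hZeq (n : ℕ) : ∫ x, Z n x ∂(M.law n θ₀) = ((n : ℝ)⁻¹ • M.fisherInfo n θ₀).trace := by
    simp only [hZ]
    rw [integral_const_mul, integral_finsetSum _ fun i _ => hsq n i, Matrix.trace_smul]
    simp [Matrix.trace, fisherInfo, pow_two]
  have hlim : Tendsto (fun n => ∫ x, Z n x ∂(M.law n θ₀)) atTop (𝓝 I.trace) := by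
    simp_rw [hZeq]
    exact ((continuous_id.matrix_trace).tendsto I).comp hreg.fisher.tendsto
  have htr : 0 ≤ I.trace := hreg.posDef.posSemidef.trace_nonneg
  obtain ⟨δ, hδ, hδε⟩ : ∃ δ : ℝ, 0 < δ ∧ ENNReal.ofReal δ ≤ ε := by
    rcases eq_or_ne ε ⊤ with h | h
    · exact ⟨1, one_pos, by simp [h]⟩
    · exact ⟨ε.toReal, ENNReal.toReal_pos hε.ne' h, by rw [ENNReal.ofReal_toReal h]⟩
  set R := √((I.trace + 1) / δ) with hR
  have hR0 : 0 < R := by positivity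
  refine ⟨R, hR0, ?_⟩
  filter_upwards [hlim.eventually_le_const (lt_add_one _), eventually_gt_atTop 0] with n hn hn0
  have : IsProbabilityMeasure (M.law n θ₀) := M.isProbabilityMeasure_law n ⟨θ₀, hθ₀⟩
  have hZ0 : ∀ x, 0 ≤ Z n x := fun x => by
    simp only [hZ]
    exact mul_nonneg (by positivity) (Finset.sum_nonneg fun i _ => sq_nonneg _)
  have hsub : {x | R < (√(n : ℝ))⁻¹ * ‖fderiv ℝ (M.logLik n x) θ₀‖} ⊆ {x | R ^ 2 ≤ Z n x} :=
    fun x hx => by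
      have h1 : R ≤ (√(n : ℝ))⁻¹ * √(∑ i, M.score n θ₀ x i ^ 2) :=
        (le_of_lt hx).trans (mul_le_mul_of_nonneg_left (norm_clm_le_sqrt_sum _) (by positivity))
      have h2 := pow_le_pow_left₀ hR0.le h1 2
      rwa [mul_pow, inv_pow, Real.sq_sqrt (Nat.cast_nonneg n),
        Real.sq_sqrt (Finset.sum_nonneg fun i _ => sq_nonneg _)] at h2
  have hmarkov := mul_meas_ge_le_integral_of_nonneg (ae_of_all _ hZ0) (hZint n) (R ^ 2)
  have hRsq : R ^ 2 = (I.trace + 1) / δ := Real.sq_sqrt (by positivity)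
  refine (measure_mono hsub).trans (le_trans ?_ hδε)
  rw [← ENNReal.ofReal_toReal (measure_ne_top (M.law n θ₀) _)]
  refine ENNReal.ofReal_le_ofReal ?_
  have h3 := hmarkov.trans hn
  have h4 : R ^ 2 * δ = I.trace + 1 := by rw [hRsq]; field_simp
  rw [← h4] at h3
  exact le_of_mul_le_mul_left h3 (by positivity)

/-- Consistency of maximum likelihood estimators. -/
theorem IsMLESeq.tendsto_law_dist (hreg : M.RegularAt θ₀ I) (hθ₀ : θ₀ ∈ M.Θ)
    {θhat : (n : ℕ) → 𝒳 n → EuclideanSpace ℝ (Fin g)} (hθhat : M.IsMLESeq θ₀ θhat)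
    {r : ℝ} (hr : 0 < r) :
    Tendsto (fun n : ℕ => M.law n θ₀ {x | θhat n x ∉ Metric.ball θ₀ r}) atTop (𝓝 0) := by
  obtain ⟨C, hCΘ, hC, hCn⟩ := hreg.identifiable_compl
  -- Finitely many identifiability neighbourhoods cover this set. An estimate there, or outside `C`,
  -- would have likelihood at least that of `θ₀`.
  have hK : IsCompact (C \ Metric.ball θ₀ r) := hC.diff Metric.isOpen_ball
  have hV : ∀ θ ∈ C \ Metric.ball θ₀ r, ∃ V ∈ 𝓝 θ,
      Tendsto (fun n : ℕ => M.law n θ₀ {x | ∃ θ' ∈ V ∩ M.Θ, M.f n θ₀ x ≤ M.f n θ' x})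
        atTop (𝓝 0) := fun θ hθ =>
    hreg.identifiable θ (hCΘ hθ.1) fun h => hθ.2 (h ▸ Metric.mem_ball_self hr)
  choose! V hVn hVt using hV
  obtain ⟨t, htK, ht⟩ := hK.elim_nhds_subcover V hVn
  have hsum : Tendsto (fun n : ℕ => M.law n θ₀
      (⋃ θ ∈ t, {x | ∃ θ' ∈ V θ ∩ M.Θ, M.f n θ₀ x ≤ M.f n θ' x})) atTop (𝓝 0) := by
    refine tendsto_of_tendsto_of_tendsto_of_le_of_le tendsto_const_nhds ?_
      (fun _ => zero_le) (fun n => measure_biUnion_finset_le t _)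
    simpa using tendsto_finsetSum t fun θ hθ => hVt θ (htK θ hθ)
  refine tendsto_measure_zero_of_eventually_subset
    (tendsto_measure_union_zero hθhat.maximizes (tendsto_measure_union_zero hCn hsum))
    (Eventually.of_forall fun n x hx => ?_)
  by_contra hcon
  simp only [Set.mem_union, not_or] at hcon
  obtain ⟨h1, h2, h3⟩ := hcon
  simp only [Set.mem_ofPred_eq, not_not] at h1
  have hmem := hθhat.mem n x
  have hle : M.f n θ₀ x ≤ M.f n (θhat n x) x := h1 hθ₀
  by_cases hxC : θhat n x ∈ C
  · obtain ⟨θ, hθt, hθV⟩ := Set.mem_iUnion₂.1 (ht ⟨hxC, hx⟩)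
    exact h3 (Set.mem_biUnion hθt ⟨θhat n x, ⟨hθV, hmem⟩, hle⟩)
  · exact h2 ⟨θhat n x, ⟨hmem, hxC⟩, hle⟩

end ModelClass

/-! ### Linearization of the estimator and of the log-likelihood ratio. -/

namespace ModelClass

variable {𝒳 : ℕ → Type*} [∀ n, MeasurableSpace (𝒳 n)] {ν : ∀ n, Measure (𝒳 n)} {g : ℕ}
  {M : ModelClass ν g} {θ₀ : EuclideanSpace ℝ (Fin g)} {I : Matrix (Fin g) (Fin g) ℝ}

theorem QuadraticNear.score_expansion {η r : ℝ} {n : ℕ} {x : 𝒳 n}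
    (hx : M.QuadraticNear θ₀ I η r n x) (hI : I.IsSymm) (hball : Metric.ball θ₀ r ⊆ M.Θ)
    {θ : EuclideanSpace ℝ (Fin g)} (hθ : θ ∈ Metric.ball θ₀ r)
    (hmax : IsMaxOn (fun θ => M.f n θ x) M.Θ θ) :
    ‖(n : ℝ) • euclideanBilin I (θ - θ₀) - fderiv ℝ (M.logLik n x) θ₀‖
      ≤ n * η * ‖θ - θ₀‖ := by
  have hlocal : IsLocalMax (M.logLik n x) θ := by
    filter_upwards [M.isOpen_Θ.mem_nhds (hball hθ)] with θ' hθ'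
    exact Real.log_le_log (hx.pos θ' hθ') (hmax hθ')
  have := (quadratic_expansion M.isOpen_Θ hx.contDiffOn (euclideanBilin_symm hI) hball
    hx.hess hθ).1
  rw [hlocal.fderiv_eq_zero] at this
  convert this using 2
  abel

theorem IsMLESeq.tendsto_law_linearization (hreg : M.RegularAt θ₀ I) (hθ₀ : θ₀ ∈ M.Θ)
    {θhat : (n : ℕ) → 𝒳 n → EuclideanSpace ℝ (Fin g)} (hθhat : M.IsMLESeq θ₀ θhat)
    {τ : EuclideanSpace ℝ (Fin g) → ℝ} (hτ : DifferentiableAt ℝ τ θ₀)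
    {h : EuclideanSpace ℝ (Fin g)} (hh : ∀ u, euclideanBilin I u h = fderiv ℝ τ θ₀ u)
    {ε : ℝ} (hε : 0 < ε) :
    Tendsto (fun n : ℕ => M.law n θ₀ {x | ε ≤ |√(n : ℝ) * (τ (θhat n x) - τ θ₀)
      - (√(n : ℝ))⁻¹ * fderiv ℝ (M.logLik n x) θ₀ h|}) atTop (𝓝 0) := by
  have hsymm : I.IsSymm := by
    simpa [Matrix.IsSymm, Matrix.IsHermitian] using hreg.posDef.isHermitian
  obtain ⟨c, hc, hcB⟩ := exists_norm_le_euclideanBilin hreg.posDef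
  rw [ENNReal.tendsto_nhds_zero]
  intro δ hδ
  obtain ⟨R, hR, hscore⟩ := hreg.exists_law_norm_score_le hθ₀ (ENNReal.half_pos hδ.ne')
  -- The bound `c/2` lets the expansion error be absorbed, giving `√n ‖Δ‖ ≤ 2R/c`. The other makes
  -- the total error `η (‖h‖ + 1) · 2R/c` at most `ε/2`.
  set η : ℝ := min (c / 2) (ε * c / (4 * (‖h‖ + 1) * R)) with hη
  have hη0 : 0 < η := by positivity
  have hηc : η ≤ c / 2 := min_le_left _ _
  have hηε : η * (4 * (‖h‖ + 1) * R) ≤ ε * c :=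
    (le_div_iff₀ (by positivity)).1 (min_le_right _ _)
  obtain ⟨r, hr, hball, hgood⟩ := hreg.exists_quadraticNear hθ₀ hη0
  have hgood0 := hgood 0
  simp only [smul_zero, add_zero] at hgood0
  have hlittle := hτ.hasFDerivAt.isLittleO.def hη0
  obtain ⟨r', hr', hball'⟩ := Metric.mem_nhds_iff.1
    (inter_mem (Metric.ball_mem_nhds θ₀ hr) hlittle)
  have hbad := tendsto_measure_union_zero hgood0
    (tendsto_measure_union_zero hθhat.maximizes (hθhat.tendsto_law_dist hreg hθ₀ hr'))
  filter_upwards [hscore, hbad.eventually_le_const (ENNReal.half_pos hδ.ne'),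
    eventually_gt_atTop 0] with n hn1 hn2 hn
  have hn' : (0 : ℝ) < n := by exact_mod_cast hn
  rw [← ENNReal.add_halves δ]
  refine (measure_mono fun x hx => ?_).trans ((measure_union_le _ _).trans (add_le_add hn1 hn2))
  by_contra hcon
  simp only [Set.mem_union, not_or, Set.mem_ofPred_eq, not_not, not_lt] at hcon
  obtain ⟨hS, hq, hmax, hnear⟩ := hcon
  set Δ := θhat n x - θ₀ with hΔ
  set D := fderiv ℝ (M.logLik n x) θ₀ with hD
  have hexp := hq.score_expansion hsymm hball (hball' hnear).1 hmax
  have hτΔ : ‖τ (θhat n x) - τ θ₀ - fderiv ℝ τ θ₀ Δ‖ ≤ η * ‖Δ‖ := (hball' hnear).2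
  rw [← hΔ, ← hD] at hexp
  set s := √(n : ℝ) with hs
  have hs0 : 0 < s := Real.sqrt_pos.2 hn'
  have hss : (n : ℝ) = s * s := (Real.mul_self_sqrt hn'.le).symm
  have hΔle : s * ‖Δ‖ * c ≤ 2 * R := by
    have h1 : (n : ℝ) * (c * ‖Δ‖) ≤ ‖D‖ + n * η * ‖Δ‖ := by
      calc (n : ℝ) * (c * ‖Δ‖) ≤ n * ‖euclideanBilin I Δ‖ := by gcongr; exact hcB Δ
        _ = ‖(n : ℝ) • euclideanBilin I Δ‖ := by rw [norm_smul, Real.norm_of_nonneg hn'.le]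
        _ ≤ ‖D‖ + ‖(n : ℝ) • euclideanBilin I Δ - D‖ := norm_le_norm_add_norm_sub' _ _
        _ ≤ ‖D‖ + n * η * ‖Δ‖ := by gcongr
    have h2 : n * η * ‖Δ‖ ≤ n * (c / 2) * ‖Δ‖ := by gcongr
    have h3 : ‖D‖ ≤ s * R := by rwa [inv_mul_le_iff₀ hs0] at hS
    rw [hss] at h1 h2
    refine le_of_mul_le_mul_left ?_ hs0
    nlinarith
  -- Evaluating the score expansion at `h` turns `I Δ` into `Dτ(Δ)`, by the choice of `h`.
  have hlin : |s * fderiv ℝ τ θ₀ Δ - s⁻¹ * D h| ≤ η * (s * ‖Δ‖) * ‖h‖ := by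
    have h1 := ((n : ℝ) • euclideanBilin I Δ - D).le_opNorm h
    have h2 : ((n : ℝ) • euclideanBilin I Δ - D) h = s * (s * fderiv ℝ τ θ₀ Δ - s⁻¹ * D h) := by
      simp only [_root_.sub_apply, _root_.smul_apply, smul_eq_mul, hh]
      rw [hss]; field_simp
    rw [h2, norm_mul, Real.norm_of_nonneg hs0.le, Real.norm_eq_abs] at h1
    have h4 := h1.trans (mul_le_mul_of_nonneg_right hexp (norm_nonneg h))
    rw [hss] at h4
    refine le_of_mul_le_mul_left (h4.trans_eq ?_) hs0
    ring
  have htot : |s * (τ (θhat n x) - τ θ₀) - s⁻¹ * D h| ≤ η * (s * ‖Δ‖) * (‖h‖ + 1) := by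
    have h1 : s * (τ (θhat n x) - τ θ₀) - s⁻¹ * D h
        = s * (τ (θhat n x) - τ θ₀ - fderiv ℝ τ θ₀ Δ) + (s * fderiv ℝ τ θ₀ Δ - s⁻¹ * D h) := by
      ring
    rw [h1]
    refine (abs_add_le _ _).trans ?_
    rw [abs_mul, abs_of_pos hs0]
    have h2 := mul_le_mul_of_nonneg_left hτΔ hs0.le
    rw [Real.norm_eq_abs] at h2
    calc _ ≤ s * (η * ‖Δ‖) + η * (s * ‖Δ‖) * ‖h‖ := add_le_add h2 hlin
      _ = _ := by ring
  have hfin : ε * c ≤ ε * c / 2 := by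
    calc ε * c ≤ η * (s * ‖Δ‖) * (‖h‖ + 1) * c := by
          gcongr
          exact le_trans hx htot
      _ = η * (‖h‖ + 1) * (s * ‖Δ‖ * c) := by ring
      _ ≤ η * (‖h‖ + 1) * (2 * R) := by gcongr
      _ = η * (4 * (‖h‖ + 1) * R) / 2 := by ring
      _ ≤ ε * c / 2 := by gcongr
  have : 0 < ε * c := by positivity
  linarith

theorem RegularAt.tendsto_law_logLik_sub (hreg : M.RegularAt θ₀ I) (hθ₀ : θ₀ ∈ M.Θ)
    (h : EuclideanSpace ℝ (Fin g)) {ε : ℝ} (hε : 0 < ε) :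
    Tendsto (fun n : ℕ => M.law n θ₀
      {x | ε ≤ |M.logLik n x (θ₀ + (√(n : ℝ))⁻¹ • h) - M.logLik n x θ₀
        - ((√(n : ℝ))⁻¹ * fderiv ℝ (M.logLik n x) θ₀ h - euclideanBilin I h h / 2)|})
      atTop (𝓝 0) := by
  have hsymm : I.IsSymm := by
    simpa [Matrix.IsSymm, Matrix.IsHermitian] using hreg.posDef.isHermitian
  have hη : 0 < ε / (‖h‖ ^ 2 + 1) := by positivity
  obtain ⟨r, hr, hball, hgood⟩ := hreg.exists_quadraticNear hθ₀ hη
  have hgood0 := hgood 0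
  simp only [smul_zero, add_zero] at hgood0
  refine tendsto_measure_zero_of_eventually_subset hgood0 ?_
  filter_upwards [eventually_gt_atTop 0,
    (tendsto_local θ₀ h).eventually (Metric.ball_mem_nhds θ₀ hr)] with n hn hnear x hx hq
  have h1 := le_trans hx (hq.local_expansion hsymm hball hn hnear)
  rw [div_mul_eq_mul_div, le_div_iff₀ (by positivity)] at h1
  linarith

end ModelClass

/-! ### The limit law. -/

theorem mainTheorem3 {𝒳 : ℕ → Type*} [∀ n, MeasurableSpace (𝒳 n)]
    (ν : ∀ n, Measure (𝒳 n)) {g : ℕ} (M : ModelClass ν g) (θ₀ : M.Θ)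
    (I : Matrix (Fin g) (Fin g) ℝ) (hreg : M.RegularAt θ₀ I)
    (θhat : (n : ℕ) → 𝒳 n → EuclideanSpace ℝ (Fin g)) (hθhat : M.IsMLESeq θ₀ θhat)
    (τ : EuclideanSpace ℝ (Fin g) → ℝ) (hτ : DifferentiableOn ℝ τ M.Θ) :
    ∃ v : ℝ≥0, (v : ℝ) = gradVec τ θ₀ ⬝ᵥ (I⁻¹ *ᵥ gradVec τ θ₀) ∧
      TendstoInDistribution
        (fun (n : ℕ) (x : 𝒳 n) => √(n : ℝ) * (τ (θhat n x) - τ θ₀)) atTop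
        (id : ℝ → ℝ) (fun n => M.law n θ₀) (gaussianReal 0 v) := by
  have hθ₀ : (θ₀ : EuclideanSpace ℝ (Fin g)) ∈ M.Θ := θ₀.2
  set h : EuclideanSpace ℝ (Fin g) := WithLp.toLp 2 (I⁻¹ *ᵥ gradVec τ θ₀) with hh
  have hdet : IsUnit I.det := (Matrix.isUnit_iff_isUnit_det I).1 hreg.posDef.isUnit
  have hBh (u : EuclideanSpace ℝ (Fin g)) :
      euclideanBilin I u h = fderiv ℝ τ θ₀ u := by
    rw [euclideanBilin_apply, EuclideanSpace.clm_apply_eq_sum (fderiv ℝ τ θ₀) u, hh,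
      mulVec_mulVec, Matrix.mul_nonsing_inv I hdet, one_mulVec]
    rfl
  have hv0 : 0 ≤ gradVec τ θ₀ ⬝ᵥ (I⁻¹ *ᵥ gradVec τ θ₀) := by
    simpa using hreg.posDef.inv.posSemidef.dotProduct_mulVec_nonneg (gradVec τ θ₀)
  have hBhh : euclideanBilin I h h = gradVec τ θ₀ ⬝ᵥ (I⁻¹ *ᵥ gradVec τ θ₀) := by
    rw [euclideanBilin_apply, hh, mulVec_mulVec, Matrix.mul_nonsing_inv I hdet, one_mulVec,
      dotProduct_comm]
  refine ⟨⟨_, hv0⟩, rfl, ?_⟩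
  -- Since `τ` is regular only on `Θ`, measurability goes through its restriction to `Θ`, where the
  -- estimators take their values.
  have hT (n : ℕ) : Measurable fun x => √(n : ℝ) * (τ (θhat n x) - τ θ₀) := by
    have h1 : Measurable (M.Θ.domRestrict τ) :=
      (continuousOn_iff_continuous_domRestrict.1 hτ.continuousOn).measurable
    have h2 : Measurable fun x => τ (θhat n x) :=
      h1.comp ((hθhat.measurable n).subtype_mk (h := hθhat.mem n))
    exact (h2.sub_const _).const_mul _
  have hlin := fun ε (hε : (0 : ℝ) < ε) => hθhat.tendsto_law_linearization hreg hθ₀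
    (hτ.differentiableAt (M.isOpen_Θ.mem_nhds hθ₀)) hBh hε
  refine tendstoInDistribution_gaussianReal_of_loglikelihood (fun n => (hT n).aemeasurable)
    (Λ := fun t n x => M.logLik n x (θ₀ + (√(n : ℝ))⁻¹ • t • h) - M.logLik n x θ₀) _
    (fun t => ?_) (fun ε hε => ?_) (fun t ε hε => ?_) (fun t K hK => ?_) (fun t ε hε => ?_)
  · filter_upwards [M.eventually_local_mem hθ₀ (t • h)] with n hn
    have h1 := M.measurable_f n _ hn
    have h2 := M.measurable_f n _ hθ₀
    simp only [ModelClass.logLik]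
    fun_prop
  · obtain ⟨R, hR, hscore⟩ := hreg.exists_law_norm_score_le hθ₀ (ENNReal.half_pos hε.ne')
    refine ⟨1 + R * ‖h‖, ?_⟩
    filter_upwards [hscore, (hlin 1 one_pos).eventually_le_const (ENNReal.half_pos hε.ne')]
      with n h1 h2
    rw [← ENNReal.add_halves ε]
    refine (measure_mono fun x hx => ?_).trans ((measure_union_le _ _).trans (add_le_add h1 h2))
    by_contra hcon
    simp only [Set.mem_union, not_or, Set.mem_ofPred_eq, not_lt, not_le] at hcon hx
    obtain ⟨c1, c2⟩ := hcon
    have c3 : |(√(n : ℝ))⁻¹ * fderiv ℝ (M.logLik n x) θ₀ h| ≤ R * ‖h‖ := by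
      rw [abs_mul, abs_of_nonneg (by positivity : (0 : ℝ) ≤ (√(n : ℝ))⁻¹)]
      calc _ ≤ (√(n : ℝ))⁻¹ * (‖fderiv ℝ (M.logLik n x) θ₀‖ * ‖h‖) := by
            gcongr
            exact (fderiv ℝ (M.logLik n x) θ₀).le_opNorm h
        _ ≤ R * ‖h‖ := by rw [← mul_assoc]; gcongr
    have c4 := abs_sub_abs_le_abs_sub (√(n : ℝ) * (τ (θhat n x) - τ θ₀))
      ((√(n : ℝ))⁻¹ * fderiv ℝ (M.logLik n x) θ₀ h)
    linarith
  -- Replacing the score term by the statistic costs `|t|` times this tolerance, less than `ε/2`;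
  -- the likelihood expansion takes the other half.
  · have ht : 0 < ε / (2 * (|t| + 1)) := by positivity
    refine tendsto_measure_zero_of_eventually_subset (tendsto_measure_union_zero
      (hreg.tendsto_law_logLik_sub hθ₀ (t • h) (half_pos hε)) (hlin _ ht))
      (Eventually.of_forall fun n x hx => ?_)
    by_contra hcon
    simp only [Set.mem_union, not_or, Set.mem_ofPred_eq, not_le] at hcon hx
    obtain ⟨c1, c2⟩ := hcon
    rw [lt_div_iff₀ (by positivity)] at c2
    simp only [map_smul, _root_.smul_apply, smul_eq_mul, hBhh] at c1
    set S := (√(n : ℝ))⁻¹ * fderiv ℝ (M.logLik n x) θ₀ h with hS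
    set T := √(n : ℝ) * (τ (θhat n x) - τ θ₀) with hTdef
    set v := gradVec τ θ₀ ⬝ᵥ (I⁻¹ *ᵥ gradVec τ θ₀) with hv
    set L := M.logLik n x (θ₀ + (√(n : ℝ))⁻¹ • t • h) - M.logLik n x θ₀ with hL
    have c3 : |L - (t * T - t ^ 2 * v / 2)| ≤
        |L - ((√(n : ℝ))⁻¹ * (t * fderiv ℝ (M.logLik n x) θ₀ h) - t * (t * v) / 2)|
          + |t| * |T - S| := by
      rw [← abs_mul, abs_mul, abs_sub_comm T S, ← abs_mul]
      refine le_trans (le_of_eq ?_) (abs_add_le _ _)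
      congr 1
      rw [hS]; ring
    have c4 : ε ≤ |L - (t * T - t ^ 2 * v / 2)| := hx
    have c5 := abs_nonneg (T - S)
    nlinarith
  · filter_upwards [M.eventually_local_mem hθ₀ (t • h)] with n hn
    exact ModelClass.integral_min_likelihoodRatio_le hreg n hθ₀ hn hK
  · obtain ⟨K, hK, htail⟩ := hreg.exists_law_local_le hθ₀ (t • h) hε
    refine ⟨K, hK, ?_⟩
    filter_upwards [htail, M.eventually_local_mem hθ₀ (t • h)] with n hn hmem
    exact ModelClass.le_integral_min_likelihoodRatio hreg n hθ₀ hmem hK hε.le hn
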